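/- Let $X$ be a nonempty compact Hausdorff space, and let $C(X)$ denote the C*-algebra of continuous complex-valued functions on $X$. Call $X$ \emph{approximately path-connected} if for every finite collection $V_1,\dots,V_s$ of nonempty open subsets of $X$ there is a continuous function $\gamma:[0,1]\to X$ such that $\gamma((0,1))\cap V_k\neq\varnothing$ for $1\le k\le s$. The following are equivalent: (1) $X$ is approximately path-connected. (2) If $\mathcal{A}$ is a unital C*-algebra, $\mathcal{B}$ is an AW*-algebra, $\eta:\mathcal{A}\to\mathcal{B}$ is a surjective unital $*$-homomorphism, and $\pi:C(X)\to\mathcal{B}$ is a unital $*$-homomorphism, then there is a net $\{\pi_\lambda\}$ of unital $*$-homomorphisms from $C(X)$ to $\mathcal{A}$ such that, for every $f\in C(X)$, $(\eta\circ\pi_\lambda)(f)\to\pi(f)$ in the weak topology on $\mathcal{B}$ (the topology $\sigma(\mathcal{B},\mathcal{B}^*)$ given by the bounded linear functionals on $\mathcal{B}$). (3) If $\mathcal{A}$ is a unital C*-algebra, $\mathcal{B}$ is a W*-algebra (a C*-algebra that is the dual of a Banach space), $\eta:\mathcal{A}\to\mathcal{B}$ is a surjective unital $*$-homomorphism, and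 $\pi:C(X)\to\mathcal{B}$ is a unital $*$-homomorphism, then there is a net $\{\pi_\lambda\}$ of unital $*$-homomorphisms from $C(X)$ to $\mathcal{A}$ such that, for every $f\in C(X)$, $(\eta\circ\pi_\lambda)(f)\to\pi(f)$ in the ultra*-strong topology on $\mathcal{B}$ (the topology given by the seminorms $x\mapsto\varphi(x^*x)^{1/2}$ and $x\mapsto\varphi(xx^*)^{1/2}$, where $\varphi$ ranges over the normal positive linear functionals on $\mathcal{B}$). (4) For every regular Borel probability measure $\nu$ on $X$ there is a net $\{\rho_\omega\}$ of unital $*$-homomorphisms from $C(X)$ into $C[0,1]$ such that, for every $f\in C(X)$, $$\int_X f\,d\nu=\lim_\omega\int_0^1\rho_\omega(f)(x)\,dx.$$ Here an AW*-algebra is a unital C*-algebra in which the right annihilator $\{x : sx=0 \text{ for all } s\in S\}$ of every subset $S$ is of the form $p\mathcal{B}$ for some projection $p$. -/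

import Mathlib

open MeasureTheory Filter Topology
open scoped ComplexOrder unitInterval

universe u v

/-- A topological space `X` is approximately path-connected if for finitely many nonempty open
subsets `V₁, …, Vₛ` there is a continuous `γ : [0,1] → X` such that `γ((0,1))` meets each `Vₖ`. -/
def ApproximatelyPathConnected (X : Type*) [TopologicalSpace X] : Prop :=
  ∀ (s : ℕ) (V : Fin s → Set X), (∀ k, IsOpen (V k)) → (∀ k, (V k).Nonempty) →
    ∃ γ : C(I, X), ∀ k, (γ '' Set.Ioo (0 : I) 1 ∩ V k).Nonempty

/-- An AW*-algebra is a (unital) C*-algebra which is a Baer *-ring: the right annihilator of every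
subset `S` is the right ideal `pB` generated by a projection `p`
(note that `x ∈ pB` if and only if `p * x = x`). -/
class AWStarAlgebra (B : Type*) [CStarAlgebra B] : Prop where
  exists_projection : ∀ S : Set B, ∃ p : B, IsStarProjection p ∧
    ∀ x : B, (∀ s ∈ S, s * x = 0) ↔ p * x = x

/-- A positive linear functional is normal if it preserves the suprema of all (bounded) upward
directed families of self-adjoint elements that have a supremum. -/
def PositiveLinearMap.IsNormalFunctional {B : Type*} [CStarAlgebra B] [PartialOrder B]
    [StarOrderedRing B] (φ : B →ₚ[ℂ] ℂ) : Prop :=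
  ∀ D : Set B, D.Nonempty → DirectedOn (· ≤ ·) D → (∀ d ∈ D, IsSelfAdjoint d) →
    ∀ a : B, IsLUB D a → IsLUB (φ '' D) (φ a)

/-- The ultra*-strong (σ-strong*) topology of a W*-algebra: the locally convex topology given by the
seminorms `x ↦ φ(x* x)^{1/2}` and `x ↦ φ(x x*)^{1/2}`, where `φ` runs over the normal positive
linear functionals. Here `φ.PreGNS` is `B` with the seminorm `x ↦ φ(x* x)^{1/2}`. -/
@[reducible]
noncomputable def ultraStarStrongTopology (B : Type*) [CStarAlgebra B] [PartialOrder B]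
    [StarOrderedRing B] : TopologicalSpace B :=
  ⨅ (φ : B →ₚ[ℂ] ℂ) (_ : φ.IsNormalFunctional),
    TopologicalSpace.induced φ.toPreGNS UniformSpace.toTopologicalSpace ⊓
      TopologicalSpace.induced (fun x : B => φ.toPreGNS (star x)) UniformSpace.toTopologicalSpace

/-!
The two lifting conditions and the condition on measures are each compared directly with
approximate path-connectedness.
By Gelfand duality the unital `*`-homomorphisms `C(X) → C(Y)` are the compositions with continuous
maps `Y → X` (`exists_continuousMap_forall_apply_eq`).

Lifting implies path-connectedness already for the restriction `η : C[0,1] → ℂˢ` to `s` interior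
times and for `π` the evaluation at `s` points: a lift of `π` is a path, and convergence, in any of
the topologies, says that the path is close to the given points at the given times
(`approximatelyPathConnected_of_lift`). For measures, the average of `s` point masses plays this
role (`approximatelyPathConnected_of_integral`).

Conversely, finitely many functions have small oscillation on the members of a finite open cover of
`X`, and there is a path through all these members
(`ApproximatelyPathConnected.exists_path_cover`). A probability measure is then approximated by
letting the path stay near the `k`-th member for the correct amount of time
(`ApproximatelyPathConnected.exists_path_integral`). For a homomorphism `π : C(X) → B` the
approximation is even in norm. The bicommutant of `π(C(X))` in `B` is a commutative C*-algebra
`C(Y)`, and `π` is composition with a map `τ : Y → X`. The space `Y` is extremally disconnected: for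
an AW*-algebra because annihilator projections of subsets of the bicommutant lie in it
(`extremallyDisconnected_of_awStarAlgebra`), for a W*-algebra because suprema of its bounded
directed subsets lie in it (`extremallyDisconnected_of_wStarAlgebra`). These suprema exist by the
Banach-Alaoglu theorem, since `[0, 1] ⊆ B` is an intersection of norm balls, so it is closed in the
weak* topology (`WStarAlgebra.exists_sup`). Hence a clopen partition of `Y` refines the preimage
under `τ` of the cover, and `π` is close in norm to a homomorphism that factors through the path by
way of a function `Y → [0, 1]`. Such a homomorphism is given by functional calculus of a self-adjoint
element of `B`, and it lifts along `η` because this element does (`exists_starAlgHom_lift`).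
-/

/-! ### Homomorphisms between algebras of continuous functions -/

/-- Gelfand duality: every unital `*`-homomorphism `C(X) → C(Y)` is composition with a continuous
map `Y → X`. -/
theorem exists_continuousMap_forall_apply_eq {X Y : Type*} [TopologicalSpace X] [CompactSpace X]
    [T2Space X] [TopologicalSpace Y] [CompactSpace Y] (ψ : C(X, ℂ) →⋆ₐ[ℂ] C(Y, ℂ)) :
    ∃ g : C(Y, X), ∀ f y, ψ f y = f (g y) := by
  let c : C(WeakDual.characterSpace ℂ C(X, ℂ), X) :=
    ⟨(WeakDual.CharacterSpace.homeoEval X ℂ).symm, Homeomorph.continuous _⟩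
  let g : C(Y, X) := c.comp
    ((WeakDual.CharacterSpace.compContinuousMap ψ).comp
      (WeakDual.CharacterSpace.continuousMapEval Y ℂ))
  refine ⟨g, fun f y => ?_⟩
  have h : WeakDual.CharacterSpace.homeoEval X ℂ (g y) =
      WeakDual.CharacterSpace.compContinuousMap ψ
        (WeakDual.CharacterSpace.continuousMapEval Y ℂ y) := by
    simp [g, c]
  exact (DFunLike.congr_fun h f).symm

/-- Urysohn's lemma for a point and a neighbourhood, with complex values. -/
theorem exists_complex_bump {X : Type*} [TopologicalSpace X] [CompactSpace X] [T2Space X]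
    {V : Set X} (hV : IsOpen V) {x : X} (hx : x ∈ V) :
    ∃ f : C(X, ℂ), f x = 1 ∧ (∀ y ∉ V, f y = 0) ∧
      ∀ y, ∃ r : ℝ, r ∈ Set.Icc (0 : ℝ) 1 ∧ f y = r := by
  obtain ⟨g, h0, h1, h01⟩ := exists_continuous_zero_one_of_isClosed hV.isClosed_compl
    (isClosed_singleton (x := x)) (by simpa using hx)
  refine ⟨⟨fun y => (g y : ℂ), by fun_prop⟩, ?_, fun y hy => ?_, fun y => ⟨g y, h01 y, rfl⟩⟩
  · simpa using h1 (Set.mem_singleton x)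
  · simpa using h0 hy

/-! ### Approximate path-connectedness from approximate lifting -/

/-- A space is approximately path-connected as soon as arbitrary values at finitely many distinct
times of the interval are approximated by paths. -/
theorem approximatelyPathConnected_of_tendsto {X : Type*} [TopologicalSpace X] [CompactSpace X]
    [T2Space X]
    (h : ∀ (s : ℕ) (x : Fin s → X) (t : Fin s → I), Function.Injective t →
      ∃ (Λ : Type v) (l : Filter Λ) (_ : l.NeBot) (γ : Λ → C(I, X)),
        ∀ (f : C(X, ℂ)) k, Tendsto (fun i => f (γ i (t k))) l (𝓝 (f (x k)))) :
    ApproximatelyPathConnected X := by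
  intro s V hVo hVne
  choose x hx using hVne
  have hpos : (0 : ℝ) < s + 1 := by positivity
  have hlt : ∀ k : Fin s, ((k : ℝ) + 1) / (s + 1) < 1 := fun k => by
    rw [div_lt_one hpos]
    have : (k : ℝ) < s := by exact_mod_cast k.2
    linarith
  let t : Fin s → I := fun k => ⟨((k : ℝ) + 1) / (s + 1), by positivity, (hlt k).le⟩
  have ht : Function.Injective t := by
    intro j k hjk
    have h1 : ((j : ℝ) + 1) / (s + 1) = ((k : ℝ) + 1) / (s + 1) := congrArg Subtype.val hjk
    rw [div_left_inj' hpos.ne'] at h1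
    exact Fin.ext (by exact_mod_cast add_right_cancel h1)
  obtain ⟨Λ, l, _, γ, hγ⟩ := h s x t ht
  choose f hf1 hf0 _ using fun k => exists_complex_bump (hVo k) (hx k)
  have hev : ∀ᶠ i in l, ∀ k, f k (γ i (t k)) ≠ 0 := by
    rw [eventually_all]
    intro k
    refine (hγ (f k) k).eventually_ne ?_
    rw [hf1 k]
    exact one_ne_zero
  obtain ⟨i, hi⟩ := hev.exists
  refine ⟨γ i, fun k => ⟨γ i (t k), ⟨t k, ⟨?_, ?_⟩, rfl⟩, ?_⟩⟩
  · exact Subtype.coe_lt_coe.1 (show (0 : ℝ) < ((k : ℝ) + 1) / (s + 1) by positivity)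
  · exact Subtype.coe_lt_coe.1 (show ((k : ℝ) + 1) / (s + 1) < (1 : ℝ) from hlt k)
  · by_contra hk
    exact hi k (hf0 k _ hk)

/-- The algebra of functions on a discrete space is an AW*-algebra: annihilators are generated by
indicator functions. -/
theorem awStarAlgebra_continuousMap (Y : Type*) [TopologicalSpace Y] [CompactSpace Y]
    [DiscreteTopology Y] : AWStarAlgebra C(Y, ℂ) where
  exists_projection S := by
    classical
    refine ⟨⟨fun y => if ∀ s ∈ S, s y = 0 then 1 else 0, continuous_of_discreteTopology⟩,
      ⟨?_, ?_⟩, fun x => ⟨fun h => ?_, fun h s hs => ?_⟩⟩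
    · ext y
      by_cases hy : ∀ s ∈ S, s y = 0 <;> simp [hy]
    · ext y
      by_cases hy : ∀ s ∈ S, s y = 0 <;> simp [hy]
    · ext y
      by_cases hy : ∀ s ∈ S, s y = 0
      · simp only [ContinuousMap.mul_apply, ContinuousMap.coe_mk, if_pos hy, one_mul]
      · have hx : x y = 0 := by
          push Not at hy
          obtain ⟨s, hs, hsy⟩ := hy
          have := DFunLike.congr_fun (h s hs) y
          simpa [hsy] using this
        simp [hx]
    · ext y
      have hy := DFunLike.congr_fun h y
      by_cases hy' : ∀ s ∈ S, s y = 0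
      · simp [hy' s hs]
      · simp [hy'] at hy
        simp [← hy]

/-- A finite-dimensional C*-algebra is the dual of its dual, hence a W*-algebra. -/
theorem wStarAlgebra_of_finiteDimensional (B : Type*) [CStarAlgebra B] [FiniteDimensional ℂ B] :
    WStarAlgebra B where
  exists_predual := by
    refine ⟨StrongDual ℂ B, inferInstance, inferInstance, inferInstance, ⟨?_⟩⟩
    have hrank : Module.finrank ℂ B = Module.finrank ℂ (StrongDual ℂ (StrongDual ℂ B)) := by
      have key : ∀ (E : Type _) [NormedAddCommGroup E] [NormedSpace ℂ E]
          [FiniteDimensional ℂ E], Module.finrank ℂ (StrongDual ℂ E) = Module.finrank ℂ E := by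
        intro E _ _ _
        rw [← LinearEquiv.finrank_eq (LinearMap.toContinuousLinearMap (𝕜 := ℂ) (E := E) (F' := ℂ))]
        exact Subspace.dual_finrank_eq
      rw [key, key]
    let e : B ≃ₗᵢ[ℂ] StrongDual ℂ (StrongDual ℂ B) :=
      (NormedSpace.inclusionInDoubleDualLi ℂ).toLinearIsometryEquiv hrank
    exact e.symm.trans (starₗᵢ ℂ)

/-- Evaluation at a point of a discrete space, as a positive functional, is normal. -/
theorem exists_normal_eval (Y : Type*) [TopologicalSpace Y] [CompactSpace Y] [DiscreteTopology Y]
    (y : Y) : ∃ φ : C(Y, ℂ) →ₚ[ℂ] ℂ, φ.IsNormalFunctional ∧ ∀ f, φ f = f y := by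
  classical
  let e : C(Y, ℂ) →ₗ[ℂ] ℂ := (ContinuousMap.evalCLM ℂ y : C(Y, ℂ) →L[ℂ] ℂ)
  refine ⟨.mk₀ e fun f hf => hf y, ?_, fun f => rfl⟩
  intro D _ _ _ a ha
  refine ⟨?_, fun c hc => ?_⟩
  · rintro _ ⟨d, hd, rfl⟩
    exact ha.1 hd y
  · -- an upper bound at `y` extends to an upper bound of `D` by keeping `a` elsewhere
    let b : C(Y, ℂ) := ⟨Function.update a y c, continuous_of_discreteTopology⟩
    have hb : b ∈ upperBounds D := by
      intro d hd z
      by_cases hz : z = y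
      · subst hz
        have hz : d z ≤ c := hc ⟨d, hd, rfl⟩
        simpa [b] using hz
      · simpa [b, hz] using ha.1 hd z
    have hy : a y ≤ b y := ha.2 hb y
    have hby : b y = c := by simp [b]
    exact hby ▸ hy

/-- Restriction of functions on the interval to finitely many points. The universe lifts let the
test algebras live in any universe. -/
noncomputable def restrictPoints {s : ℕ} (t : Fin s → I) :
    C(ULift.{v} I, ℂ) →⋆ₐ[ℂ] C(ULift.{v} (Fin s), ℂ) :=
  ContinuousMap.compStarAlgHom' ℂ ℂ
    ⟨fun k => ⟨t k.down⟩, continuous_of_discreteTopology⟩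

theorem restrictPoints_apply {s : ℕ} (t : Fin s → I) (f : C(ULift.{v} I, ℂ)) (k : ULift (Fin s)) :
    restrictPoints t f k = f ⟨t k.down⟩ := rfl

theorem restrictPoints_surjective {s : ℕ} {t : Fin s → I} (ht : Function.Injective t) :
    Function.Surjective (restrictPoints.{v} t) := by
  intro f
  have he : IsClosedEmbedding (fun k : ULift.{v} (Fin s) => (⟨t k.down⟩ : ULift.{v} I)) :=
    Continuous.isClosedEmbedding continuous_of_discreteTopology fun j k hjk =>
      ULift.ext _ _ (ht (congrArg ULift.down hjk))
  obtain ⟨g, hg⟩ := ContinuousMap.exists_extension he f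
  exact ⟨g, hg⟩

/-- Evaluation at finitely many points. -/
noncomputable def evalPoints {X : Type*} [TopologicalSpace X] {s : ℕ} (x : Fin s → X) :
    C(X, ℂ) →⋆ₐ[ℂ] C(ULift.{v} (Fin s), ℂ) :=
  ContinuousMap.compStarAlgHom' ℂ ℂ ⟨fun k => x k.down, continuous_of_discreteTopology⟩

theorem evalPoints_apply {X : Type*} [TopologicalSpace X] {s : ℕ} (x : Fin s → X) (f : C(X, ℂ))
    (k : ULift.{v} (Fin s)) : evalPoints x f k = f (x k.down) := rfl

/-- Lifting `evalPoints x` approximately along all restrictions `restrictPoints t`, even only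
pointwise, forces approximate path-connectedness. -/
theorem approximatelyPathConnected_of_lift {X : Type u} [TopologicalSpace X] [CompactSpace X]
    [T2Space X]
    (h : ∀ (s : ℕ) (x : Fin s → X) (t : Fin s → I), Function.Injective t →
      ∃ (Λ : Type (max u v)) (_ : Preorder Λ) (_ : IsDirectedOrder Λ) (_ : Nonempty Λ)
        (ρ : Λ → (C(X, ℂ) →⋆ₐ[ℂ] C(ULift.{v} I, ℂ))), ∀ (f : C(X, ℂ)) (k : ULift.{v} (Fin s)),
          Tendsto (fun i => restrictPoints t (ρ i f) k) atTop (𝓝 (evalPoints x f k))) :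
    ApproximatelyPathConnected X := by
  refine approximatelyPathConnected_of_tendsto fun s x t ht => ?_
  obtain ⟨Λ, _, _, _, ρ, hρ⟩ := h s x t ht
  choose g hg using fun i => exists_continuousMap_forall_apply_eq (ρ i)
  refine ⟨Λ, atTop, inferInstance, fun i => (g i).comp ⟨ULift.up, continuous_uliftUp⟩,
    fun f k => ?_⟩
  have := hρ f ⟨k⟩
  simp only [restrictPoints_apply, evalPoints_apply, hg] at this
  exact this

theorem approximatelyPathConnected_of_weak_lift {X : Type u} [TopologicalSpace X] [CompactSpace X]
    [T2Space X]
    (h : ∀ (A B : Type v) [CStarAlgebra A] [CStarAlgebra B] [AWStarAlgebra B]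
        (η : A →⋆ₐ[ℂ] B) (_ : Function.Surjective η) (π : C(X, ℂ) →⋆ₐ[ℂ] B),
        ∃ (Λ : Type (max u v)) (_ : Preorder Λ) (_ : IsDirectedOrder Λ) (_ : Nonempty Λ)
          (πnet : Λ → (C(X, ℂ) →⋆ₐ[ℂ] A)),
          ∀ f : C(X, ℂ), Tendsto (fun l => toWeakSpace ℂ B (η (πnet l f))) atTop
            (𝓝 (toWeakSpace ℂ B (π f)))) : ApproximatelyPathConnected X := by
  refine approximatelyPathConnected_of_lift.{u, v} fun s x t ht => ?_
  have := awStarAlgebra_continuousMap (ULift.{v} (Fin s))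
  obtain ⟨Λ, i1, i2, i3, ρ, hρ⟩ := h C(ULift.{v} I, ℂ) C(ULift.{v} (Fin s), ℂ) (restrictPoints t)
    (restrictPoints_surjective ht) (evalPoints x)
  refine ⟨Λ, i1, i2, i3, ρ, fun f k => ?_⟩
  have he := WeakBilin.eval_continuous
    (topDualPairing ℂ C(ULift.{v} (Fin s), ℂ)).flip
    (ContinuousMap.evalCLM ℂ k : C(ULift.{v} (Fin s), ℂ) →L[ℂ] ℂ)
  exact (he.tendsto _).comp (hρ f)

theorem approximatelyPathConnected_of_ultraStarStrong_lift {X : Type u} [TopologicalSpace X]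
    [CompactSpace X] [T2Space X]
    (h : ∀ (A B : Type v) [CStarAlgebra A] [CStarAlgebra B] [WStarAlgebra B]
        [PartialOrder B] [StarOrderedRing B]
        (η : A →⋆ₐ[ℂ] B) (_ : Function.Surjective η) (π : C(X, ℂ) →⋆ₐ[ℂ] B),
        ∃ (Λ : Type (max u v)) (_ : Preorder Λ) (_ : IsDirectedOrder Λ) (_ : Nonempty Λ)
          (πnet : Λ → (C(X, ℂ) →⋆ₐ[ℂ] A)),
          ∀ f : C(X, ℂ), Tendsto (fun l => η (πnet l f)) atTop
            (@nhds B (ultraStarStrongTopology B) (π f))) : ApproximatelyPathConnected X := by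
  refine approximatelyPathConnected_of_lift.{u, v} fun s x t ht => ?_
  have : FiniteDimensional ℂ C(ULift.{v} (Fin s), ℂ) :=
    Module.Finite.of_injective (ContinuousMap.coeFnLinearMap ℂ) DFunLike.coe_injective
  have := wStarAlgebra_of_finiteDimensional C(ULift.{v} (Fin s), ℂ)
  obtain ⟨Λ, i1, i2, i3, ρ, hρ⟩ := h C(ULift.{v} I, ℂ) C(ULift.{v} (Fin s), ℂ) (restrictPoints t)
    (restrictPoints_surjective ht) (evalPoints x)
  refine ⟨Λ, i1, i2, i3, ρ, fun f k => ?_⟩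
  obtain ⟨φ, hφ, hφk⟩ := exists_normal_eval (ULift.{v} (Fin s)) k
  have h1 : Tendsto (fun i => φ.toPreGNS (restrictPoints t (ρ i f))) atTop
      (𝓝 (φ.toPreGNS (evalPoints x f))) := by
    have hc : @Continuous _ _ (ultraStarStrongTopology _) _ φ.toPreGNS :=
      continuous_iff_le_induced.2 ((iInf₂_le φ hφ).trans inf_le_left)
    exact (@Continuous.tendsto _ _ (ultraStarStrongTopology _) _ _ hc _).comp (hρ f)
  rw [tendsto_iff_norm_sub_tendsto_zero] at h1 ⊢
  refine h1.congr fun i => ?_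
  rw [← map_sub, PositiveLinearMap.preGNS_norm_def, PositiveLinearMap.ofPreGNS_toPreGNS, hφk]
  rw [← ContinuousMap.sub_apply]
  generalize restrictPoints t (ρ i f) - evalPoints x f = z
  rw [ContinuousMap.mul_apply, ContinuousMap.star_apply, Complex.star_def,
    ← Complex.normSq_eq_conj_mul_self, Complex.ofReal_re, Complex.normSq_eq_norm_sq,
    Real.sqrt_sq (norm_nonneg _)]

/-! ### Paths and measures -/

/-- Finitely many functions on an approximately path-connected space are controlled along a path:
some finite open cover has a point of the path in each of its members, and the functions have small
oscillation on each member. -/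
theorem ApproximatelyPathConnected.exists_path_cover {X : Type*} [TopologicalSpace X]
    [CompactSpace X] (hX : ApproximatelyPathConnected X) (F : Finset C(X, ℂ)) {ε : ℝ}
    (hε : 0 < ε) :
    ∃ (s : ℕ) (V : Fin s → Set X) (γ : C(I, X)) (t : Fin s → I), (∀ k, IsOpen (V k)) ∧
      (∀ x, ∃ k, x ∈ V k) ∧ ∀ f ∈ F, ∀ k, ∀ x ∈ V k, ‖f (γ (t k)) - f x‖ < ε := by
  let U : X → Set X := fun x => ⋂ f ∈ F, {y | ‖f y - f x‖ < ε / 2}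
  have hUo : ∀ x, IsOpen (U x) := fun x =>
    isOpen_biInter_finset fun f _ => isOpen_lt (by fun_prop) continuous_const
  have hU : ∀ x, x ∈ U x := fun x => by simp [U, hε]
  obtain ⟨T, hT⟩ := CompactSpace.elim_nhds_subcover U fun x => (hUo x).mem_nhds (hU x)
  let e := T.equivFin
  let V : Fin T.card → Set X := fun k => U (e.symm k)
  obtain ⟨γ, hγ⟩ := hX T.card V (fun k => hUo _) fun k => ⟨_, hU _⟩
  have ht : ∀ k, ∃ t : I, γ t ∈ V k := fun k => by
    obtain ⟨_, ⟨t, _, rfl⟩, h⟩ := hγ k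
    exact ⟨t, h⟩
  choose t ht using ht
  refine ⟨T.card, V, γ, t, fun k => hUo _, fun x => ?_, fun f hf k x hx => ?_⟩
  · have hx : x ∈ ⋃ x ∈ T, U x := hT ▸ Set.mem_univ x
    simp only [Set.mem_iUnion] at hx
    obtain ⟨z, hz, hxz⟩ := hx
    exact ⟨e ⟨z, hz⟩, by simpa [V] using hxz⟩
  · have h1 : ‖f (γ (t k)) - f (e.symm k)‖ < ε / 2 := Set.mem_iInter₂.1 (ht k) f hf
    have h2 : ‖f x - f (e.symm k)‖ < ε / 2 := Set.mem_iInter₂.1 hx f hf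
    calc ‖f (γ (t k)) - f x‖ = ‖(f (γ (t k)) - f (e.symm k)) - (f x - f (e.symm k))‖ := by
          congr 1; ring
      _ ≤ _ := norm_sub_le _ _
      _ < ε := by linarith

/-- The index of the first member of a finite cover that contains a given point. -/
theorem exists_first_index {Y : Type*} {s : ℕ} {V : Fin s → Set Y} (hV : ∀ y, ∃ k, y ∈ V k) :
    ∃ i : Y → Fin s, (∀ y, y ∈ V (i y)) ∧ ∀ k, i ⁻¹' {k} = V k \ ⋃ j < k, V j := by
  classical
  have h : ∀ y, ∃ k, y ∈ V k ∧ ∀ j < k, y ∉ V j := fun y => by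
    obtain ⟨k, hk, hmin⟩ := wellFounded_lt.has_min {k | y ∈ V k} (hV y)
    exact ⟨k, hk, fun j hj hy => hmin j hy hj⟩
  choose i hi hlt using h
  refine ⟨i, hi, fun k => ?_⟩
  ext y
  simp only [Set.mem_preimage, Set.mem_singleton_iff, Set.mem_sdiff, Set.mem_iUnion, not_exists]
  constructor
  · rintro rfl
    exact ⟨hi y, hlt y⟩
  · rintro ⟨hk, hk'⟩
    rcases lt_trichotomy (i y) k with h | h | h
    · exact absurd (hi y) (hk' _ h)
    · exact h
    · exact absurd hk (hlt y _ h)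

/-- A measurable self-map of the interval is an almost everywhere limit of continuous ones. -/
theorem exists_continuousMap_tendsto_ae {g : I → I} (hg : Measurable g) :
    ∃ φ : ℕ → C(I, I), ∀ᵐ u : I, Tendsto (fun n => φ n u) atTop (𝓝 (g u)) := by
  let G : I → ℝ := fun u => g u
  have hGm : Measurable G := measurable_subtype_coe.comp hg
  have hG : MemLp G 1 (volume : Measure I) := by
    refine MemLp.of_bound hGm.aestronglyMeasurable 1 (Eventually.of_forall fun u => ?_)
    rw [Real.norm_eq_abs, abs_of_nonneg (g u).2.1]
    exact (g u).2.2
  have hex : ∀ n : ℕ, ∃ b : BoundedContinuousFunction I ℝ,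
      eLpNorm (G - ⇑b) 1 (volume : Measure I) ≤ ((n : ENNReal) + 1)⁻¹ := fun n => by
    obtain ⟨b, hb, -⟩ := hG.exists_boundedContinuous_eLpNorm_sub_le (by simp)
      (ε := ((n : ENNReal) + 1)⁻¹) (by simp)
    exact ⟨b, hb⟩
  choose b hb using hex
  have hlim : Tendsto (fun n => eLpNorm (⇑(b n) - G) 1 (volume : Measure I)) atTop (𝓝 0) := by
    refine tendsto_of_tendsto_of_tendsto_of_le_of_le tendsto_const_nhds ?_ (fun n => zero_le)
      (fun n => (eLpNorm_sub_comm _ _ _ _).trans_le (hb n))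
    exact_mod_cast (ENNReal.tendsto_inv_nat_nhds_zero.comp (tendsto_add_atTop_nat 1))
  obtain ⟨ns, -, hns⟩ := (tendstoInMeasure_of_tendsto_eLpNorm one_ne_zero
    (fun n => (b n).continuous.aestronglyMeasurable) hGm.aestronglyMeasurable
    hlim).exists_seq_tendsto_ae
  refine ⟨fun n => ⟨fun u => Set.projIcc 0 1 zero_le_one (b (ns n) u), by fun_prop⟩, ?_⟩
  filter_upwards [hns] with u hu
  have h := (continuous_projIcc (h := zero_le_one' ℝ)).tendsto (G u) |>.comp hu
  rwa [show Set.projIcc 0 1 (zero_le_one' ℝ) (G u) = g u from Set.projIcc_val _ _] at h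

/-- On an approximately path-connected space, a probability measure is approximated on finitely
many functions by the image of Lebesgue measure under a path. The path follows a continuous
approximation of a step function whose steps have the masses of the pieces of a small partition. -/
theorem ApproximatelyPathConnected.exists_path_integral {X : Type*} [TopologicalSpace X]
    [CompactSpace X] [MeasurableSpace X] [BorelSpace X] (hX : ApproximatelyPathConnected X)
    (ν : Measure X) [IsProbabilityMeasure ν] (F : Finset C(X, ℂ)) {ε : ℝ} (hε : 0 < ε) :
    ∃ γ : C(I, X), ∀ f ∈ F, ‖(∫ u : I, f (γ u)) - ∫ x, f x ∂ν‖ < ε := by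
  obtain ⟨s, V, γ, t, hVo, hV, hγ⟩ := hX.exists_path_cover F (half_pos hε)
  obtain ⟨i, hiV, hi⟩ := exists_first_index hV
  have him : Measurable i := measurable_to_countable' fun k => by
    rw [hi k]
    exact (hVo k).measurableSet.diff
      (MeasurableSet.iUnion fun j => MeasurableSet.iUnion fun _ => (hVo j).measurableSet)
  have : Nonempty (Fin s) := by
    obtain ⟨x⟩ := nonempty_of_isProbabilityMeasure ν
    exact ⟨i x⟩
  have : IsProbabilityMeasure (ν.map i) := Measure.isProbabilityMeasure_map him.aemeasurable
  obtain ⟨g, hgm, hg⟩ := (ν.map i).exists_measurable_map_eq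
  have htm : Measurable t := measurable_from_top
  obtain ⟨φ, hφ⟩ := exists_continuousMap_tendsto_ae (htm.comp hgm)
  have hlim : ∀ f : C(X, ℂ), Tendsto (fun n => ∫ u : I, f (γ (φ n u))) atTop
      (𝓝 (∫ x, f (γ (t (i x))) ∂ν)) := by
    intro f
    have h1 : ∫ x, f (γ (t (i x))) ∂ν = ∫ u : I, f (γ (t (g u))) := by
      have hm : StronglyMeasurable fun k => f (γ (t k)) := .of_discrete
      rw [← integral_map him.aemeasurable (f := fun k => f (γ (t k))) hm.aestronglyMeasurable,
        ← hg, integral_map hgm.aemeasurable hm.aestronglyMeasurable]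
    rw [h1]
    refine tendsto_integral_of_dominated_convergence (fun _ => ‖f‖) (fun n => ?_)
      (integrable_const _) (fun n => Eventually.of_forall fun u => f.norm_coe_le_norm _) ?_
    · exact Continuous.aestronglyMeasurable (by fun_prop)
    · filter_upwards [hφ] with u hu
      have hc : Continuous fun v => f (γ v) := by fun_prop
      exact (hc.tendsto _).comp hu
  have hev : ∀ᶠ n in atTop, ∀ f ∈ F,
      ‖(∫ u : I, f (γ (φ n u))) - ∫ x, f (γ (t (i x))) ∂ν‖ < ε / 2 := by
    rw [Filter.eventually_all_finset]
    intro f _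
    simpa [dist_eq_norm] using (Metric.tendsto_nhds.1 (hlim f)) (ε / 2) (half_pos hε)
  obtain ⟨n, hn⟩ := hev.exists
  refine ⟨γ.comp (φ n), fun f hf => ?_⟩
  have hint : ∀ f : C(X, ℂ), Integrable f ν := fun f =>
    Integrable.of_bound f.continuous.aestronglyMeasurable ‖f‖
      (Eventually.of_forall fun x => f.norm_coe_le_norm x)
  have hstep : ‖(∫ x, f (γ (t (i x))) ∂ν) - ∫ x, f x ∂ν‖ ≤ ε / 2 := by
    have hint' : Integrable (fun x => f (γ (t (i x)))) ν :=
      Integrable.of_bound ((StronglyMeasurable.of_discrete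
        (f := fun k => f (γ (t k)))).comp_measurable him).aestronglyMeasurable ‖f‖
        (Eventually.of_forall fun x => f.norm_coe_le_norm _)
    rw [← integral_sub hint' (hint f)]
    have := norm_integral_le_of_norm_le_const (μ := ν) (C := ε / 2)
      (f := fun x => f (γ (t (i x))) - f x)
      (Eventually.of_forall fun x => (hγ f hf (i x) x (hiV x)).le)
    simpa using this
  calc _ = ‖((∫ u : I, f (γ (φ n u))) - ∫ x, f (γ (t (i x))) ∂ν) +
        ((∫ x, f (γ (t (i x))) ∂ν) - ∫ x, f x ∂ν)‖ := by simp
    _ ≤ _ := norm_add_le _ _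
    _ < ε := by linarith [hn f hf]

/-- Finite subsets of `C(X)`, ordered by inclusion, and precisions `1 / (n + 1)`, ordered by `n`,
index the approximating nets. The last factor only adjusts the universe. -/
abbrev ApproxIndex (X : Type u) [TopologicalSpace X] : Type (max u v) :=
  Finset C(X, ℂ) × ℕ × PUnit.{v + 1}

theorem ApproxIndex.eventually_lt {X : Type u} [TopologicalSpace X] (f : C(X, ℂ)) {ε : ℝ}
    (hε : 0 < ε) :
    ∀ᶠ l : ApproxIndex.{u, v} X in atTop, f ∈ l.1 ∧ 1 / ((l.2.1 : ℝ) + 1) < ε := by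
  classical
  obtain ⟨n, hn⟩ := exists_nat_one_div_lt hε
  filter_upwards [eventually_ge_atTop (({f}, n, PUnit.unit) : ApproxIndex.{u, v} X)] with l hl
  have h1 : ({f} : Finset C(X, ℂ)) ≤ l.1 := hl.1
  have h2 : (n : ℝ) ≤ l.2.1 := by exact_mod_cast hl.2.1
  refine ⟨h1 (Finset.mem_singleton_self f), lt_of_le_of_lt ?_ hn⟩
  exact one_div_le_one_div_of_le (by positivity) (by linarith)

theorem ApproximatelyPathConnected.exists_net_tendsto_integral {X : Type u} [TopologicalSpace X]
    [CompactSpace X] [MeasurableSpace X] [BorelSpace X] (hX : ApproximatelyPathConnected X)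
    (ν : Measure X) [IsProbabilityMeasure ν] :
    ∃ (Ω : Type u) (_ : Preorder Ω) (_ : IsDirectedOrder Ω) (_ : Nonempty Ω)
      (ρ : Ω → (C(X, ℂ) →⋆ₐ[ℂ] C(I, ℂ))),
      ∀ f : C(X, ℂ), Tendsto (fun w => ∫ t : I, ρ w f t) atTop (𝓝 (∫ x, f x ∂ν)) := by
  classical
  choose γ hγ using fun l : ApproxIndex.{u, 0} X =>
    hX.exists_path_integral ν l.1 (Nat.one_div_pos_of_nat (α := ℝ) (n := l.2.1))
  refine ⟨ApproxIndex.{u, 0} X, inferInstance, inferInstance, inferInstance,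
    fun l => ContinuousMap.compStarAlgHom' ℂ ℂ (γ l), fun f => ?_⟩
  rw [Metric.tendsto_nhds]
  intro ε hε
  filter_upwards [ApproxIndex.eventually_lt f hε] with l hl
  rw [dist_eq_norm]
  exact (hγ l f hl.1).trans hl.2

/-- The normalized counting measure on a finite family of points. -/
noncomputable def pointAverage {X : Type*} [MeasurableSpace X] {s : ℕ} (x : Fin s → X) :
    Measure X :=
  ∑ k, (s : ENNReal)⁻¹ • Measure.dirac (x k)

theorem isProbabilityMeasure_pointAverage {X : Type*} [MeasurableSpace X] {s : ℕ} (hs : s ≠ 0)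
    (x : Fin s → X) : IsProbabilityMeasure (pointAverage x) := by
  refine ⟨?_⟩
  simp [pointAverage, ENNReal.mul_inv_cancel, hs]

theorem innerRegular_dirac {X : Type*} [TopologicalSpace X] [MeasurableSpace X] (x : X) :
    (Measure.dirac x).InnerRegular := by
  refine ⟨fun A hA r hr => ?_⟩
  by_cases hx : x ∈ A
  · refine ⟨{x}, by simpa using hx, isCompact_singleton, hr.trans_le ?_⟩
    exact prob_le_one.trans_eq (Measure.dirac_apply_of_mem (Set.mem_singleton x)).symm
  · rw [Measure.dirac_apply' x hA] at hr
    simp [hx] at hr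

theorem approximatelyPathConnected_of_integral {X : Type u} [TopologicalSpace X]
    [CompactSpace X] [T2Space X] [Nonempty X] [MeasurableSpace X] [BorelSpace X]
    (h : ∀ (ν : Measure X) [IsProbabilityMeasure ν] [ν.Regular],
        ∃ (Ω : Type u) (_ : Preorder Ω) (_ : IsDirectedOrder Ω) (_ : Nonempty Ω)
          (ρ : Ω → (C(X, ℂ) →⋆ₐ[ℂ] C(I, ℂ))),
          ∀ f : C(X, ℂ), Tendsto (fun w => ∫ t : I, ρ w f t) atTop (𝓝 (∫ x, f x ∂ν))) :
    ApproximatelyPathConnected X := by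
  intro s V hVo hVne
  rcases Nat.eq_zero_or_pos s with rfl | hs
  · exact ⟨ContinuousMap.const _ (Classical.arbitrary X), fun k => k.elim0⟩
  choose x hx using hVne
  choose f hf1 hf0 hf01 using fun k => exists_complex_bump (hVo k) (hx k)
  have := isProbabilityMeasure_pointAverage hs.ne' x
  have hr : (pointAverage x).InnerRegular := by
    have := fun k => innerRegular_dirac (x k)
    unfold pointAverage
    infer_instance
  obtain ⟨Ω, _, _, _, ρ, hρ⟩ := h (pointAverage x)
  choose γ hγ using fun w => exists_continuousMap_forall_apply_eq (ρ w)
  have hint : ∀ k, ∫ y, f k y ∂(pointAverage x) ≠ 0 := by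
    intro k h0
    have hd : ∀ j ∈ (Finset.univ : Finset (Fin s)),
        Integrable (f k) ((s : ENNReal)⁻¹ • Measure.dirac (x j)) := fun j _ =>
      (Integrable.of_bound (f k).continuous.aestronglyMeasurable ‖f k‖
        (Eventually.of_forall fun y => (f k).norm_coe_le_norm y)).smul_measure (by simp [hs.ne'])
    rw [pointAverage, integral_finsetSum_measure hd] at h0
    simp only [integral_smul_measure] at h0
    rw [← Finset.smul_sum, smul_eq_zero] at h0
    have hd' : ∀ j, ∫ y, f k y ∂(Measure.dirac (x j)) = f k (x j) := fun j =>
      integral_dirac' _ _ (f k).continuous.stronglyMeasurable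
    simp only [hd'] at h0
    rcases h0 with h0 | h0
    · simp [hs.ne'] at h0
    · have hnn : ∀ j, 0 ≤ f k (x j) := fun j => by
        obtain ⟨r, hr, he⟩ := hf01 k (x j)
        rw [he]
        exact_mod_cast hr.1
      have := (Finset.sum_eq_zero_iff_of_nonneg fun j _ => hnn j).1 h0 k (Finset.mem_univ k)
      rw [hf1 k] at this
      exact one_ne_zero this
  have hev : ∀ᶠ w in atTop, ∀ k, ∫ u : I, ρ w (f k) u ≠ 0 := by
    rw [eventually_all]
    exact fun k => (hρ (f k)).eventually_ne (hint k)
  obtain ⟨w, hw⟩ := hev.exists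
  refine ⟨γ w, fun k => ?_⟩
  by_contra hk
  refine hw k (integral_eq_zero_of_ae ?_)
  have h0 : ∀ a : I, ∀ᵐ u : I, u ≠ a := fun a => by
    simp [ae_iff]
  filter_upwards [h0 0, h0 1] with u hu0 hu1
  rw [hγ]
  refine hf0 k _ fun hu => hk ⟨γ w u, ⟨u, ⟨?_, ?_⟩, rfl⟩, hu⟩
  · exact lt_of_le_of_ne u.2.1 (Ne.symm hu0)
  · exact lt_of_le_of_ne u.2.2 hu1

/-! ### Suprema in algebras with a predual -/

open scoped ComplexStarModule in
/-- The order interval `[0, 1]` of a C*-algebra is an intersection of norm balls. The balls centred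
at imaginary scalars cut out the self-adjoint elements of norm at most one. -/
theorem nonneg_and_le_one_iff_norm {B : Type*} [CStarAlgebra B] [PartialOrder B]
    [StarOrderedRing B] (x : B) :
    (0 ≤ x ∧ x ≤ 1) ↔
      (∀ n : ℝ, ‖x + (n * Complex.I) • (1 : B)‖ ≤ √(1 + n ^ 2)) ∧ ‖1 - x‖ ≤ 1 := by
  have h1 : ‖(1 : B)‖ ≤ 1 := (CStarAlgebra.norm_le_one_iff_of_nonneg 1 zero_le_one).2 le_rfl
  constructor
  · rintro ⟨h0, hx⟩
    have hsa : star x = x := (IsSelfAdjoint.of_nonneg h0).star_eq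
    have hxn : ‖x‖ ≤ 1 := (CStarAlgebra.norm_le_one_iff_of_nonneg x h0).2 hx
    refine ⟨fun n => Real.le_sqrt_of_sq_le ?_, ?_⟩
    · have he : star (x + (n * Complex.I) • (1 : B)) * (x + (n * Complex.I) • (1 : B)) =
          x * x + ((n : ℂ) ^ 2) • (1 : B) := by
        have hc : star ((n : ℂ) * Complex.I) = -(n * Complex.I) := by simp
        rw [star_add, star_smul, star_one, hsa, hc, add_mul, mul_add, mul_add, smul_mul_smul_comm,
          neg_smul, neg_mul, one_mul, mul_smul_comm, smul_mul_assoc, mul_one, one_mul,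
          neg_mul, neg_smul]
        have : (n : ℂ) * Complex.I * (n * Complex.I) = -(n : ℂ) ^ 2 := by
          linear_combination (n : ℂ) ^ 2 * Complex.I_sq
        rw [this]
        module
      rw [sq, ← CStarRing.norm_star_mul_self, he]
      refine (norm_add_le _ _).trans (add_le_add ?_ ?_)
      · exact (norm_mul_le _ _).trans (mul_le_one₀ hxn (norm_nonneg _) hxn)
      · rw [norm_smul, norm_pow, Complex.norm_real, Real.norm_eq_abs, sq_abs]
        exact mul_le_of_le_one_right (sq_nonneg n) h1
    · rw [CStarAlgebra.norm_le_one_iff_of_nonneg _ (sub_nonneg.2 hx)]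
      exact sub_le_self _ h0
  · rintro ⟨hn, hx1⟩
    rcases subsingleton_or_nontrivial B with hB | hB
    · exact ⟨(Subsingleton.elim _ _).le, (Subsingleton.elim _ _).le⟩
    have him : (ℑ x : B) = 0 := by
      refine CFC.eq_zero_of_spectrum_subset_zero (R := ℝ) _ (fun l hl => ?_) (ℑ x).2
      have key : ∀ n : ℝ, (l + n) ^ 2 ≤ 1 + n ^ 2 := fun n => by
        have hmem : l + n ∈ spectrum ℝ ((ℑ x : B) + algebraMap ℝ B n) := by
          rwa [add_comm (ℑ x : B), spectrum.add_mem_add_iff]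
        have hc : ((ℑ (x + ((n : ℂ) * Complex.I) • (1 : B)) : selfAdjoint B) : B) =
            (ℑ x : B) + algebraMap ℝ B n := by
          rw [map_add, mul_comm, mul_smul, imaginaryPart_I_smul]
          have : IsSelfAdjoint ((n : ℂ) • (1 : B)) := by
            simp [isSelfAdjoint_iff]
          rw [AddSubgroup.coe_add, this.coe_realPart, Algebra.algebraMap_eq_smul_one]
          simp
        have h2 := (spectrum.norm_le_norm_of_mem hmem).trans
          ((congrArg norm hc.symm).le.trans ((imaginaryPart.norm_le _).trans (hn n)))
        have h3 := pow_le_pow_left₀ (norm_nonneg _) h2 2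
        rwa [Real.norm_eq_abs, sq_abs, Real.sq_sqrt (by positivity)] at h3
      by_contra hl0
      have hl0 : l ≠ 0 := hl0
      -- `key n` says `l ^ 2 + 2 * l * n ≤ 1`, and `n = 1 / l` makes the middle term equal to `2`
      have := key (1 / l)
      have e : (l + 1 / l) ^ 2 = l ^ 2 + 2 + (1 / l) ^ 2 := by
        field_simp
        ring
      nlinarith [sq_nonneg l]
    have hsa : IsSelfAdjoint x := by
      have := realPart_add_I_smul_imaginaryPart x
      rw [him, smul_zero, add_zero] at this
      rw [← this]
      exact (ℜ x).2
    have hxn : ‖x‖ ≤ 1 := by simpa using hn 0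
    have hle : ∀ y : B, IsSelfAdjoint y → ‖y‖ ≤ 1 → y ≤ 1 := fun y hy hyn => by
      refine (hy.le_algebraMap_norm_self).trans ?_
      rw [← map_one (algebraMap ℝ B)]
      exact algebraMap_mono B hyn
    refine ⟨?_, hle x hsa hxn⟩
    have := hle (1 - x) ((IsSelfAdjoint.one B).sub hsa) hx1
    simpa using this

/-- The order interval `[0, 1]`, being an intersection of norm balls, is closed for the
weak* topology that a predual induces. -/
theorem mem_Icc_of_tendsto_weakDual {E B ι : Type*} [NormedAddCommGroup E] [NormedSpace ℂ E]
    [CStarAlgebra B] [PartialOrder B] [StarOrderedRing B] (e : StrongDual ℂ E ≃ₗᵢ⋆[ℂ] B)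
    {l : Filter ι} [l.NeBot] {x : ι → B} {a : B}
    (hx : Tendsto (fun i => StrongDual.toWeakDual (e.symm (x i))) l
      (𝓝 (StrongDual.toWeakDual (e.symm a))))
    (h : ∀ᶠ i in l, 0 ≤ x i ∧ x i ≤ 1) : 0 ≤ a ∧ a ≤ 1 := by
  have ball : ∀ (c : B) (r : ℝ), (∀ᶠ i in l, ‖x i - c‖ ≤ r) → ‖a - c‖ ≤ r := by
    intro c r hr
    have := (WeakDual.isClosed_closedBall (e.symm c) r).mem_of_tendsto hx (hr.mono fun i hi => by
      change dist (e.symm (x i)) (e.symm c) ≤ r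
      rwa [e.symm.dist_map, dist_eq_norm])
    have : dist (e.symm a) (e.symm c) ≤ r := this
    rwa [e.symm.dist_map, dist_eq_norm] at this
  rw [nonneg_and_le_one_iff_norm]
  refine ⟨fun n => ?_, ?_⟩
  · rw [← sub_neg_eq_add]
    refine ball _ _ (h.mono fun i hi => ?_)
    rw [sub_neg_eq_add]
    exact ((nonneg_and_le_one_iff_norm _).1 hi).1 n
  · rw [norm_sub_rev]
    refine ball _ _ (h.mono fun i hi => ?_)
    rw [norm_sub_rev]
    exact ((nonneg_and_le_one_iff_norm _).1 hi).2

/-- In a W*-algebra, an upward directed subset of `[0, 1]` has a supremum in `[0, 1]`, namely a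
weak* cluster point. -/
theorem WStarAlgebra.exists_sup {B : Type*} [CStarAlgebra B] [WStarAlgebra B] [PartialOrder B]
    [StarOrderedRing B] {D : Set B} (hne : D.Nonempty) (hdir : DirectedOn (· ≤ ·) D)
    (hD : ∀ d ∈ D, 0 ≤ d ∧ d ≤ 1) :
    ∃ a : B, (0 ≤ a ∧ a ≤ 1) ∧ (∀ d ∈ D, d ≤ a) ∧
      ∀ c : B, c ≤ 1 → (∀ d ∈ D, d ≤ c) → a ≤ c := by
  obtain ⟨E, _, _, _, ⟨e⟩⟩ := WStarAlgebra.exists_predual (M := B)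
  have : Nonempty D := hne.to_subtype
  have : IsDirectedOrder D := directedOn_iff_isDirectedOrder.1 hdir
  let 𝓤 : Ultrafilter D := Ultrafilter.of atTop
  have h𝓤 : (𝓤 : Filter D) ≤ atTop := Ultrafilter.of_le _
  let T : B → WeakDual ℂ E := fun x => StrongDual.toWeakDual (e.symm x)
  have hball : ∀ d : D, T d ∈ WeakDual.toStrongDual ⁻¹' Metric.closedBall (0 : StrongDual ℂ E) 1 :=
    fun d => by
      change dist (e.symm (d : B)) 0 ≤ 1
      rw [dist_zero_right, e.symm.norm_map]
      exact (CStarAlgebra.norm_le_one_iff_of_nonneg _ (hD d d.2).1).2 (hD d d.2).2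
  obtain ⟨w, -, hw⟩ := (WeakDual.isCompact_closedBall (0 : StrongDual ℂ E) 1).ultrafilter_le_nhds
    (𝓤.map fun d : D => T d) (by
      rw [le_principal_iff]
      exact mem_map.2 (Eventually.of_forall hball))
  obtain ⟨a, rfl⟩ : ∃ a, T a = w := ⟨e (WeakDual.toStrongDual w), by simp [T]⟩
  have hlim : Tendsto (fun d : D => T d) 𝓤 (𝓝 (T a)) := hw
  refine ⟨a, mem_Icc_of_tendsto_weakDual e hlim (Eventually.of_forall fun d => hD d d.2),
    fun d hd => ?_, fun c hc1 hc => ?_⟩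
  · have h1 : Tendsto (fun d' : D => T (d' - d)) 𝓤 (𝓝 (T (a - d))) := by
      simpa only [T, map_sub] using hlim.sub_const (T d)
    refine sub_nonneg.1 (mem_Icc_of_tendsto_weakDual e h1 ?_).1
    filter_upwards [h𝓤 (eventually_ge_atTop ⟨d, hd⟩)] with d' hd'
    exact ⟨sub_nonneg.2 hd', (sub_le_self _ (hD d hd).1).trans (hD d' d'.2).2⟩
  · have h1 : Tendsto (fun d' : D => T (c - d')) 𝓤 (𝓝 (T (c - a))) := by
      simpa only [T, map_sub] using hlim.const_sub (T c)
    refine sub_nonneg.1 (mem_Icc_of_tendsto_weakDual e h1 (Eventually.of_forall fun d' => ?_)).1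
    exact ⟨sub_nonneg.2 (hc d' d'.2), (sub_le_self _ (hD d' d'.2).1).trans hc1⟩

/-! ### The bicommutant of a commutative image -/

theorem mem_centralizer_range_iff {X B : Type*} [TopologicalSpace X] [CStarAlgebra B]
    (π : C(X, ℂ) →⋆ₐ[ℂ] B) (c : B) :
    c ∈ StarSubalgebra.centralizer ℂ (Set.range π) ↔ ∀ f, π f * c = c * π f := by
  rw [StarSubalgebra.mem_centralizer_iff]
  constructor
  · exact fun h f => (h _ ⟨f, rfl⟩).1
  · rintro h _ ⟨f, rfl⟩
    refine ⟨h f, ?_⟩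
    rw [← map_star]
    exact h _

/-- The bicommutant of the image of `π : C(X) → B` is a commutative C*-algebra, so `π` factors
through some `C(Y)` that is embedded in `B` with this bicommutant as its range. -/
theorem exists_bicommutant_representation {X : Type u} {B : Type v} [TopologicalSpace X]
    [CompactSpace X] [T2Space X] [CStarAlgebra B] (π : C(X, ℂ) →⋆ₐ[ℂ] B) :
    ∃ (Y : Type v) (_ : TopologicalSpace Y) (_ : CompactSpace Y) (_ : T2Space Y)
      (ι : C(Y, ℂ) →⋆ₐ[ℂ] B) (τ : C(Y, X)), Function.Injective ι ∧
      (∀ b : B, (∀ c, (∀ f, π f * c = c * π f) → c * b = b * c) → ∃ q, ι q = b) ∧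
      (∀ q c, (∀ f, π f * c = c * π f) → c * ι q = ι q * c) ∧
      ∀ f : C(X, ℂ), π f = ι (f.comp τ) := by
  let C := StarSubalgebra.centralizer ℂ (Set.range π)
  let M := StarSubalgebra.centralizer ℂ (C : Set B)
  have hC : ∀ c, c ∈ C ↔ ∀ f, π f * c = c * π f := mem_centralizer_range_iff π
  have hM : ∀ b, b ∈ M ↔ ∀ c ∈ C, c * b = b * c := fun b => by
    rw [StarSubalgebra.mem_centralizer_iff]
    exact ⟨fun h c hc => (h c hc).1, fun h c hc => ⟨h c hc, h _ (star_mem hc)⟩⟩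
  have hπC : ∀ f, π f ∈ C := fun f => (hC _).2 fun g => by
    rw [← map_mul, ← map_mul, mul_comm]
  have hπM : ∀ f, π f ∈ M := fun f => (hM _).2 fun c hc => ((hC c).1 hc f).symm
  have hMC : ∀ b ∈ M, b ∈ C := fun b hb => (hC b).2 fun f => (hM b).1 hb _ (hπC f)
  have hclosed : IsClosed (M : Set B) := by
    rw [StarSubalgebra.coe_centralizer]
    exact Set.isClosed_centralizer _
  let inst : CommCStarAlgebra M :=
    { (inferInstance : CStarAlgebra M) with
      mul_comm := fun x y => Subtype.ext ((hM y).1 y.2 x (hMC x x.2)) }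
  let G := gelfandStarTransform M
  let π' : C(X, ℂ) →⋆ₐ[ℂ] C(WeakDual.characterSpace ℂ M, ℂ) :=
    (G : M →⋆ₐ[ℂ] C(WeakDual.characterSpace ℂ M, ℂ)).comp (π.codRestrict M hπM)
  obtain ⟨τ, hτ⟩ := exists_continuousMap_forall_apply_eq π'
  let ι : C(WeakDual.characterSpace ℂ M, ℂ) →⋆ₐ[ℂ] B :=
    M.subtype.comp (G.symm : C(WeakDual.characterSpace ℂ M, ℂ) →⋆ₐ[ℂ] M)
  have hι : ∀ q, ι q = (G.symm q : B) := fun q => rfl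
  refine ⟨WeakDual.characterSpace ℂ M, inferInstance, inferInstance, inferInstance, ι, τ,
    ?_, fun b hb => ?_, fun q c hc => ?_, fun f => ?_⟩
  · exact Subtype.val_injective.comp G.symm.injective
  · refine ⟨G ⟨b, (hM b).2 fun c hc => hb c ((hC c).1 hc)⟩, ?_⟩
    rw [hι, G.symm_apply_apply]
  · exact (hM _).1 (G.symm q).2 c ((hC c).2 hc)
  · have : f.comp τ = G ⟨π f, hπM f⟩ := by
      ext y
      exact (hτ f y).symm
    rw [this, hι, G.symm_apply_apply]

/-- The zero set of an idempotent of `C(Y)` is clopen. -/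
theorem isClopen_zeros_of_idempotent {Y : Type*} [TopologicalSpace Y] {q : C(Y, ℂ)}
    (hq : ∀ y, q y = 0 ∨ q y = 1) : IsClopen {y | q y = 0} := by
  refine ⟨isClosed_eq q.continuous continuous_const, ?_⟩
  have : {y | q y = 0} = {y | q y ≠ 1} := by
    ext y
    rcases hq y with h | h <;> simp [h]
  rw [this]
  exact isOpen_ne_fun q.continuous continuous_const

/-- In an AW*-algebra the bicommutant contains the annihilator projections of its subsets. The
annihilator of the functions supported in an open set `U` is generated by the indicator function of
the complement of `closure U`, which is therefore clopen. -/
theorem extremallyDisconnected_of_awStarAlgebra {X B Y : Type*} [TopologicalSpace X]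
    [CStarAlgebra B] [AWStarAlgebra B] {π : C(X, ℂ) →⋆ₐ[ℂ] B}
    [TopologicalSpace Y] [CompactSpace Y] [T2Space Y] {ι : C(Y, ℂ) →⋆ₐ[ℂ] B}
    (hinj : Function.Injective ι)
    (hmem : ∀ b : B, (∀ c, (∀ f, π f * c = c * π f) → c * b = b * c) → ∃ q, ι q = b)
    (hcomm : ∀ q c, (∀ f, π f * c = c * π f) → c * ι q = ι q * c) :
    ExtremallyDisconnected Y where
  open_closure U hU := by
    obtain ⟨p, hp, hpS⟩ := AWStarAlgebra.exists_projection (ι '' {f | ∀ y ∉ U, f y = 0})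
    have hpp : p * p = p := hp.isIdempotentElem
    have hps : star p = p := hp.isSelfAdjoint
    have hann : ∀ f : C(Y, ℂ), (∀ y ∉ U, f y = 0) → ι f * p = 0 := fun f hf =>
      (hpS p).2 hpp _ ⟨f, hf, rfl⟩
    have hpc : ∀ c, (∀ f, π f * c = c * π f) → p * (c * p) = c * p := fun c hc =>
      (hpS _).1 (by
        rintro _ ⟨f, hf, rfl⟩
        rw [← mul_assoc, ← hcomm f c hc, mul_assoc, hann f hf, mul_zero])
    obtain ⟨q, rfl⟩ := hmem p fun c hc => by
      have hc' : ∀ f, π f * star c = star c * π f := fun f => by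
        have := congrArg star (hc (star f))
        rw [star_mul, star_mul, ← map_star, star_star] at this
        exact this.symm
      have h1 := congrArg star (hpc _ hc')
      rw [star_mul, star_mul, star_star, hps, mul_assoc, hpc c hc] at h1
      exact h1
    have hq : ∀ y, q y = 0 ∨ q y = 1 := fun y => by
      have h1 : q * q = q := hinj (by rw [map_mul, hpp])
      have h2 : q y * q y = q y := DFunLike.congr_fun h1 y
      by_cases h0 : q y = 0
      · exact Or.inl h0
      · exact Or.inr (mul_left_cancel₀ h0 (by rw [h2, mul_one]))
    have hcl : closure U = {y | q y = 0} := by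
      refine Set.Subset.antisymm ?_ fun y hy => ?_
      · refine closure_minimal (fun y hy => ?_) (isClopen_zeros_of_idempotent hq).1
        obtain ⟨f, hf1, hf0, -⟩ := exists_complex_bump hU hy
        have h1 : f * q = 0 := hinj (by rw [map_mul, hann f hf0, map_zero])
        have h2 : f y * q y = 0 := DFunLike.congr_fun h1 y
        simpa [hf1] using h2
      · by_contra hyU
        obtain ⟨g, hg1, hg0, -⟩ := exists_complex_bump isClosed_closure.isOpen_compl hyU
        have h1 : ι q * ι g = ι g := (hpS _).1 (by
          rintro _ ⟨f, hf, rfl⟩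
          rw [← map_mul, ← map_zero ι]
          congr 1
          ext z
          by_cases hz : z ∈ U
          · simp [hg0 z (not_not.2 (subset_closure hz))]
          · simp [hf z hz])
        have h2 : q y * g y = g y := DFunLike.congr_fun (hinj ((map_mul ι q g).trans h1)) y
        rw [hg1, mul_one, show q y = 0 from hy] at h2
        exact zero_ne_one h2
    rw [hcl]
    exact (isClopen_zeros_of_idempotent hq).2

/-- An injective `*`-homomorphism out of `C(Y)` reflects positivity. -/
theorem nonneg_of_map_nonneg {B Y : Type*} [CStarAlgebra B] [PartialOrder B] [StarOrderedRing B]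
    [TopologicalSpace Y] [CompactSpace Y] {ι : C(Y, ℂ) →⋆ₐ[ℂ] B} (hinj : Function.Injective ι)
    {f : C(Y, ℂ)} (hf : 0 ≤ ι f) : 0 ≤ f := by
  have hsa : star f = f := hinj (by rw [map_star, (IsSelfAdjoint.of_nonneg hf).star_eq])
  have him : ∀ y, ((f y).re : ℂ) = f y := fun y =>
    Complex.conj_eq_iff_re.1 (DFunLike.congr_fun hsa y)
  -- compress `f` by its negative part `k`: the result `-k ^ 3` is both positive and negative
  let k : C(Y, ℂ) := ⟨fun y => ((max (-(f y).re) 0 : ℝ) : ℂ), by fun_prop⟩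
  have hk : star k = k := by
    ext y
    simp [k]
  have hk3 : 0 ≤ k * k * k := fun y => by
    have h0 : 0 ≤ k y := Complex.zero_le_real.2 (le_max_right _ _)
    exact mul_nonneg (mul_nonneg h0 h0) h0
  have hfk : k * f * k = -(k * k * k) := by
    ext y
    simp only [ContinuousMap.mul_apply, ContinuousMap.neg_apply, k, ContinuousMap.coe_mk]
    rw [← him y]
    norm_cast
    rcases le_total (f y).re 0 with h | h
    · rw [max_eq_left (neg_nonneg.2 h)]
      ring
    · rw [max_eq_right (neg_nonpos.2 h)]
      ring
  have h1 : 0 ≤ ι (k * f * k) := by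
    have := star_left_conjugate_nonneg hf (ι k)
    rwa [← map_star, hk, ← map_mul, ← map_mul] at this
  have h2 : 0 ≤ ι (k * k * k) := map_nonneg ι hk3
  rw [hfk, map_neg, neg_nonneg] at h1
  have h3 : k * k * k = 0 := hinj (by rw [le_antisymm h1 h2, map_zero])
  intro y
  have h4 : k y * k y * k y = 0 := DFunLike.congr_fun h3 y
  have h5 : k y = 0 := by simpa using h4
  have h6 : max (-(f y).re) 0 = 0 := Complex.ofReal_eq_zero.1 h5
  have h7 : 0 ≤ (f y).re := neg_nonpos.1 (max_eq_right_iff.1 h6)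
  change 0 ≤ f y
  rw [← him y]
  exact Complex.zero_le_real.2 h7

/-- An element of a C*-algebra commutes with a star-closed commutant as soon as it is dominated by
its conjugates under the unitaries of that commutant, because unitaries span. -/
theorem commute_of_forall_unitary_le {X B : Type*} [TopologicalSpace X] [CStarAlgebra B]
    [PartialOrder B] [StarOrderedRing B] (π : C(X, ℂ) →⋆ₐ[ℂ] B) {a : B}
    (ha : ∀ v ∈ unitary B, (∀ f, π f * v = v * π f) → a ≤ v * a * star v)
    {c : B} (hc : ∀ f, π f * c = c * π f) : c * a = a * c := by
  let C := StarSubalgebra.centralizer ℂ (Set.range π)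
  have hC : ∀ c, c ∈ C ↔ ∀ f, π f * c = c * π f := mem_centralizer_range_iff π
  have hclosed : IsClosed (C : Set B) := by
    rw [StarSubalgebra.coe_centralizer]
    exact Set.isClosed_centralizer _
  -- domination by the conjugates under both `v` and `star v` forces equality
  have hu : ∀ v ∈ unitary B, v ∈ C → v * a = a * v := fun v hv hvC => by
    have h1 := ha v hv ((hC v).1 hvC)
    have h2 := star_right_conjugate_le_conjugate
      (ha (star v) (Unitary.star_mem hv) ((hC _).1 (star_mem hvC))) v
    rw [star_star] at h2
    have h3 : v * (star v * a * v) * star v = a := by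
      simp only [← mul_assoc, Unitary.mul_star_self_of_mem hv, one_mul]
      rw [mul_assoc, Unitary.mul_star_self_of_mem hv, mul_one]
    rw [h3] at h2
    have h4 : v * a * star v = a := le_antisymm h2 h1
    calc v * a = v * a * (star v * v) := by rw [Unitary.star_mul_self_of_mem hv, mul_one]
      _ = a * v := by rw [← mul_assoc, h4]
  obtain ⟨w, k, hwk, -⟩ := CStarAlgebra.exists_sum_four_unitary (⟨c, (hC c).2 hc⟩ : C)
  have hcsum : c = ∑ i, k i • ((w i : C) : B) := by
    simpa using congrArg (Subtype.val : C → B) hwk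
  rw [hcsum, Finset.sum_mul, Finset.mul_sum]
  refine Finset.sum_congr rfl fun i _ => ?_
  rw [smul_mul_assoc, mul_smul_comm, hu _ _ (w i : C).2]
  have h1 := Unitary.mem_iff.1 (w i).2
  exact Unitary.mem_iff.2 ⟨congrArg Subtype.val h1.1, congrArg Subtype.val h1.2⟩

/-- In a W*-algebra the bicommutant contains the suprema of its directed subsets. The supremum of
the functions with values in `[0, 1]` supported in an open set `U` is the indicator function of
`closure U`, which is therefore clopen. -/
theorem extremallyDisconnected_of_wStarAlgebra {X B Y : Type*} [TopologicalSpace X]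
    [CStarAlgebra B] [WStarAlgebra B] [PartialOrder B] [StarOrderedRing B]
    {π : C(X, ℂ) →⋆ₐ[ℂ] B}
    [TopologicalSpace Y] [CompactSpace Y] [T2Space Y] {ι : C(Y, ℂ) →⋆ₐ[ℂ] B}
    (hinj : Function.Injective ι)
    (hmem : ∀ b : B, (∀ c, (∀ f, π f * c = c * π f) → c * b = b * c) → ∃ q, ι q = b)
    (hcomm : ∀ q c, (∀ f, π f * c = c * π f) → c * ι q = ι q * c) :
    ExtremallyDisconnected Y where
  open_closure U hU := by
    have hle : ∀ f g : C(Y, ℂ), ι f ≤ ι g → ∀ y, f y ≤ g y := fun f g h y => by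
      have h1 : 0 ≤ ι (g - f) := by rwa [map_sub, sub_nonneg]
      exact sub_nonneg.1 (nonneg_of_map_nonneg hinj h1 y)
    have hmono : ∀ f g : C(Y, ℂ), (∀ y, f y ≤ g y) → ι f ≤ ι g := fun f g h =>
      OrderHomClass.mono ι h
    let κ : C(Y, ℝ) → C(Y, ℂ) := fun f => ⟨fun y => (f y : ℂ), by fun_prop⟩
    have hκ : ∀ f y, κ f y = (f y : ℂ) := fun _ _ => rfl
    let S : Set C(Y, ℝ) := {f | (∀ y, 0 ≤ f y ∧ f y ≤ 1) ∧ ∀ y ∉ U, f y = 0}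
    let D : Set B := (fun f => ι (κ f)) '' S
    have hne : D.Nonempty := ⟨_, 0, ⟨fun y => by simp, fun y _ => rfl⟩, rfl⟩
    have hdir : DirectedOn (· ≤ ·) D := by
      rintro _ ⟨f, hf, rfl⟩ _ ⟨g, hg, rfl⟩
      refine ⟨_, ⟨f ⊔ g, ⟨fun y => ⟨?_, ?_⟩, fun y hy => ?_⟩, rfl⟩, hmono _ _ fun y => ?_,
        hmono _ _ fun y => ?_⟩
      · exact (hf.1 y).1.trans le_sup_left
      · exact sup_le (hf.1 y).2 (hg.1 y).2
      · simp [hf.2 y hy, hg.2 y hy]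
      · exact Complex.real_le_real.2 le_sup_left
      · exact Complex.real_le_real.2 le_sup_right
    have hD : ∀ d ∈ D, 0 ≤ d ∧ d ≤ 1 := by
      rintro _ ⟨f, hf, rfl⟩
      constructor
      · rw [← map_zero ι]
        exact hmono _ _ fun y => Complex.zero_le_real.2 (hf.1 y).1
      · rw [← map_one ι]
        refine hmono _ _ fun y => ?_
        exact Complex.real_le_real.2 (hf.1 y).2
    obtain ⟨a, ⟨ha0, ha1⟩, hub, hlub⟩ := WStarAlgebra.exists_sup hne hdir hD
    obtain ⟨q, rfl⟩ := hmem a fun c hc => by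
      refine commute_of_forall_unitary_le π (fun v hv hvc => hlub _ ?_ fun d hd => ?_) hc
      · have := star_right_conjugate_le_conjugate ha1 v
        rwa [mul_one, Unitary.mul_star_self_of_mem hv] at this
      · have h1 := star_right_conjugate_le_conjugate (hub d hd) v
        have h2 : v * d * star v = d := by
          obtain ⟨f, -, rfl⟩ := hd
          rw [hcomm _ v hvc, mul_assoc, Unitary.mul_star_self_of_mem hv, mul_one]
        rwa [h2] at h1
    have hq1 : ∀ y, q y ≤ 1 := hle q 1 (by rwa [map_one])
    have hq0 : ∀ y, 0 ≤ q y := hle 0 q (by rwa [map_zero])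
    have hcl : ∀ y ∈ closure U, q y = 1 := by
      intro y hy
      refine closure_minimal (t := {y | q y = 1}) (fun z hz => ?_)
        (isClosed_eq q.continuous continuous_const) hy
      obtain ⟨g, hg0, hg1, hg⟩ := exists_continuous_zero_one_of_isClosed hU.isClosed_compl
        (isClosed_singleton (x := z)) (by simpa using hz)
      have h1 := hle _ _ (hub _ ⟨g, ⟨fun y => hg y, fun y hy => hg0 hy⟩, rfl⟩) z
      have h2 : g z = 1 := hg1 (Set.mem_singleton z)
      rw [hκ, h2, Complex.ofReal_one] at h1
      exact le_antisymm (hq1 z) h1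
    have hncl : ∀ y ∉ closure U, q y = 0 := by
      intro y hy
      obtain ⟨g, hg0, hg1, hg⟩ := exists_continuous_zero_one_of_isClosed
        (isClosed_singleton (x := y)) (isClosed_closure (s := U)) (by simpa using hy)
      have h1 := hle q (κ g) (hlub _ (by
        rw [← map_one ι]
        refine hmono _ _ fun y => ?_
        exact Complex.real_le_real.2 (hg y).2) (by
        rintro _ ⟨f, hf, rfl⟩
        refine hmono _ _ fun z => Complex.real_le_real.2 ?_
        by_cases hz : z ∈ U
        · rw [hg1 (subset_closure hz)]
          exact (hf.1 z).2
        · rw [hf.2 z hz]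
          exact (hg z).1)) y
      have h2 : g y = 0 := hg0 (Set.mem_singleton y)
      rw [hκ, h2, Complex.ofReal_zero] at h1
      exact le_antisymm h1 (hq0 y)
    have hcl' : closure U = {y | q y = 0}ᶜ := by
      ext y
      by_cases hy : y ∈ closure U
      · simp [hy, hcl y hy]
      · simp [hy, hncl y hy]
    rw [hcl']
    refine (isClopen_zeros_of_idempotent fun y => ?_).1.isOpen_compl
    by_cases hy : y ∈ closure U
    · exact Or.inr (hcl y hy)
    · exact Or.inl (hncl y hy)

/-! ### Norm approximation -/

theorem continuous_of_starAlgHom {A B : Type*} [CStarAlgebra A] [CStarAlgebra B]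
    (φ : A →⋆ₐ[ℂ] B) : Continuous φ :=
  AddMonoidHomClass.continuous_of_bound φ 1 fun x => by
    simpa using NonUnitalStarAlgHom.norm_apply_le φ x

/-- Homomorphisms `C(X) → C(Y) → B` that factor through a path `γ` lift exactly: lift the image of
`θ : Y → [0, 1]` to a self-adjoint element, clamp its spectrum to `[0, 1]`, and apply `γ` by
functional calculus. -/
theorem exists_starAlgHom_lift {X Y A B : Type*} [TopologicalSpace X] [TopologicalSpace Y]
    [CompactSpace Y] [CStarAlgebra A] [CStarAlgebra B] {η : A →⋆ₐ[ℂ] B}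
    (hη : Function.Surjective η) (ι : C(Y, ℂ) →⋆ₐ[ℂ] B) (γ : C(I, X)) (θ : C(Y, I)) :
    ∃ ρ : C(X, ℂ) →⋆ₐ[ℂ] A, ∀ f : C(X, ℂ), η (ρ f) = ι (f.comp (γ.comp θ)) := by
  let h : C(Y, ℂ) := ⟨fun y => ((θ y : ℝ) : ℂ), by fun_prop⟩
  have hh : star (ι h) = ι h := by
    rw [← map_star]
    congr 1
    ext y
    simp [h]
  obtain ⟨b, hb⟩ := hη (ι h)
  let a : A := realPart b
  have ha : IsSelfAdjoint a := (realPart b).2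
  have hηa : η a = ι h := by
    have h1 : a = (2⁻¹ : ℝ) • (b + star b) := realPart_apply_coe b
    have h2 : η ((2⁻¹ : ℝ) • (b + star b)) = (2⁻¹ : ℝ) • η (b + star b) := by
      have := map_smul η ((2⁻¹ : ℝ) : ℂ) (b + star b)
      simpa only [Complex.coe_smul] using this
    rw [h1, h2, map_add, map_star, hb, hh, ← two_smul ℝ, smul_smul]
    norm_num
  let z : C(ℂ, I) := ⟨fun w => Set.projIcc 0 1 zero_le_one w.re, by fun_prop⟩
  have hzθ : ∀ y, z (h y) = θ y := fun y => Set.projIcc_val zero_le_one (θ y)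
  let r : C(spectrum ℂ a, X) := (γ.comp z).restrict (spectrum ℂ a)
  refine ⟨(cfcHom (R := ℂ) ha.isStarNormal).comp (ContinuousMap.compStarAlgHom' ℂ ℂ r),
    fun f => ?_⟩
  let F : C(ℂ, ℂ) := f.comp (γ.comp z)
  have h1 : cfcHom (R := ℂ) ha.isStarNormal (f.comp r) = cfc F a :=
    (cfc_apply F a ha.isStarNormal F.continuous.continuousOn).symm
  have h2 : cfc F h = f.comp (γ.comp θ) := by
    ext y
    have h3 := StarAlgHomClass.map_cfc (ContinuousMap.evalStarAlgHom ℂ ℂ y) F h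
      F.continuous.continuousOn (continuous_eval_const y) ⟨mul_comm _ _⟩ ⟨mul_comm _ _⟩
    have h4 : cfc F (h y) = F (h y) := cfc_algebraMap (A := ℂ) (h y) F
    exact (h3.trans h4).trans (congrArg (fun u => f (γ u)) (hzθ y))
  calc η (cfcHom (R := ℂ) ha.isStarNormal (f.comp r)) = η (cfc F a) := by rw [h1]
    _ = cfc F (η a) := StarAlgHomClass.map_cfc η F a F.continuous.continuousOn (continuous_of_starAlgHom η)
        ha.isStarNormal (ha.map η).isStarNormal
    _ = cfc F (ι h) := by rw [hηa]
    _ = ι (cfc F h) := (StarAlgHomClass.map_cfc ι F h F.continuous.continuousOn (continuous_of_starAlgHom ι)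
        ⟨mul_comm _ _⟩ (hηa ▸ (ha.map η).isStarNormal)).symm
    _ = _ := by rw [h2]

/-- If `π` factors through functions on an extremally disconnected space, then it is approximately
liftable in norm: small covers of `X` pull back to covers that clopen partitions refine. -/
theorem ApproximatelyPathConnected.exists_starAlgHom_norm_lt {X Y A B : Type*}
    [TopologicalSpace X] [CompactSpace X] (hX : ApproximatelyPathConnected X)
    [TopologicalSpace Y] [CompactSpace Y] [T2Space Y] [ExtremallyDisconnected Y]
    [CStarAlgebra A] [CStarAlgebra B] {η : A →⋆ₐ[ℂ] B} (hη : Function.Surjective η)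
    {π : C(X, ℂ) →⋆ₐ[ℂ] B} (ι : C(Y, ℂ) →⋆ₐ[ℂ] B) (τ : C(Y, X))
    (hπ : ∀ f : C(X, ℂ), π f = ι (f.comp τ)) (F : Finset C(X, ℂ)) {ε : ℝ} (hε : 0 < ε) :
    ∃ ρ : C(X, ℂ) →⋆ₐ[ℂ] A, ∀ f ∈ F, ‖η (ρ f) - π f‖ < ε := by
  obtain ⟨s, V, γ, t, hVo, hV, hγ⟩ := hX.exists_path_cover F hε
  let U : Fin s → TopologicalSpace.Opens Y := fun k => ⟨τ ⁻¹' V k, (hVo k).preimage τ.continuous⟩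
  have hU : TopologicalSpace.IsOpenCover U := by
    rw [TopologicalSpace.IsOpenCover, eq_top_iff]
    intro y _
    rw [TopologicalSpace.Opens.mem_iSup]
    exact hV (τ y)
  obtain ⟨n, W, hW, hWc⟩ := hU.exists_finite_clopen_cover
  choose k hk using fun j => (hW j)
  obtain ⟨i, hiW, hi⟩ := exists_first_index (V := fun j => (W j : Set Y)) fun y => by
    simpa using hWc (Set.mem_univ y)
  have hic : Continuous i := continuous_discrete_rng.2 fun j => by
    rw [hi j]
    exact (W j).isOpen.sdiff
      (isClosed_iUnion_of_finite fun l => isClosed_iUnion_of_finite fun _ => (W l).isClosed)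
  let θ : C(Y, I) := ⟨fun y => t (k (i y)), (continuous_of_discreteTopology (f := fun j => t (k j))).comp hic⟩
  obtain ⟨ρ, hρ⟩ := exists_starAlgHom_lift hη ι γ θ
  refine ⟨ρ, fun f hf => ?_⟩
  rw [hρ, hπ, ← map_sub]
  refine (NonUnitalStarAlgHom.norm_apply_le ι _).trans_lt ?_
  rw [ContinuousMap.norm_lt_iff _ hε]
  exact fun y => hγ f hf _ _ (hk _ (hiW y))

theorem ApproximatelyPathConnected.exists_net_tendsto {X : Type u} {Y : Type*} {A B : Type v}
    [TopologicalSpace X] [CompactSpace X] (hX : ApproximatelyPathConnected X)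
    [TopologicalSpace Y] [CompactSpace Y] [T2Space Y] [ExtremallyDisconnected Y]
    [CStarAlgebra A] [CStarAlgebra B] {η : A →⋆ₐ[ℂ] B} (hη : Function.Surjective η)
    {π : C(X, ℂ) →⋆ₐ[ℂ] B} (ι : C(Y, ℂ) →⋆ₐ[ℂ] B) (τ : C(Y, X))
    (hπ : ∀ f : C(X, ℂ), π f = ι (f.comp τ)) :
    ∃ (Λ : Type (max u v)) (_ : Preorder Λ) (_ : IsDirectedOrder Λ) (_ : Nonempty Λ)
      (ρ : Λ → (C(X, ℂ) →⋆ₐ[ℂ] A)), ∀ f : C(X, ℂ),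
        Tendsto (fun l => η (ρ l f)) atTop (𝓝 (π f)) := by
  classical
  choose ρ hρ using fun l : ApproxIndex.{u, v} X =>
    hX.exists_starAlgHom_norm_lt hη ι τ hπ l.1 (Nat.one_div_pos_of_nat (α := ℝ) (n := l.2.1))
  refine ⟨ApproxIndex.{u, v} X, inferInstance, inferInstance, inferInstance, ρ, fun f => ?_⟩
  rw [Metric.tendsto_nhds]
  intro ε hε
  filter_upwards [ApproxIndex.eventually_lt f hε] with l hl
  rw [dist_eq_norm]
  exact (hρ l f hl.1).trans hl.2

/-- The norm topology is finer than the ultra*-strong topology. -/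
theorem le_ultraStarStrongTopology (B : Type*) [CStarAlgebra B] [PartialOrder B]
    [StarOrderedRing B] : UniformSpace.toTopologicalSpace ≤ ultraStarStrongTopology B := by
  have hc : ∀ φ : B →ₚ[ℂ] ℂ, Continuous φ.toPreGNS := fun φ => by
    obtain ⟨K, hK⟩ := φ.exists_norm_apply_le
    refine AddMonoidHomClass.continuous_of_bound φ.toPreGNS (√K) fun x => ?_
    rw [PositiveLinearMap.preGNS_norm_def, PositiveLinearMap.ofPreGNS_toPreGNS,
      ← Real.sqrt_sq (norm_nonneg x), ← Real.sqrt_mul K.coe_nonneg]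
    refine Real.sqrt_le_sqrt ((Complex.re_le_norm _).trans ((hK _).trans_eq ?_))
    rw [CStarRing.norm_star_mul_self, sq]
  refine le_iInf₂ fun φ _ => le_inf ?_ ?_
  · exact continuous_iff_le_induced.1 (hc φ)
  · exact continuous_iff_le_induced.1 ((hc φ).comp continuous_star)

/-! ### The equivalence -/

theorem mainTheorem3 (X : Type u) [TopologicalSpace X] [CompactSpace X] [T2Space X]
    [Nonempty X] [MeasurableSpace X] [BorelSpace X] :
    List.TFAE [
      ApproximatelyPathConnected X,
      ∀ (A B : Type v) [CStarAlgebra A] [CStarAlgebra B] [AWStarAlgebra B]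
        (η : A →⋆ₐ[ℂ] B) (_ : Function.Surjective η) (π : C(X, ℂ) →⋆ₐ[ℂ] B),
        ∃ (Λ : Type (max u v)) (_ : Preorder Λ) (_ : IsDirectedOrder Λ) (_ : Nonempty Λ)
          (πnet : Λ → (C(X, ℂ) →⋆ₐ[ℂ] A)),
          ∀ f : C(X, ℂ), Tendsto (fun l => toWeakSpace ℂ B (η (πnet l f))) atTop
            (𝓝 (toWeakSpace ℂ B (π f))),
      ∀ (A B : Type v) [CStarAlgebra A] [CStarAlgebra B] [WStarAlgebra B]
        [PartialOrder B] [StarOrderedRing B]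
        (η : A →⋆ₐ[ℂ] B) (_ : Function.Surjective η) (π : C(X, ℂ) →⋆ₐ[ℂ] B),
        ∃ (Λ : Type (max u v)) (_ : Preorder Λ) (_ : IsDirectedOrder Λ) (_ : Nonempty Λ)
          (πnet : Λ → (C(X, ℂ) →⋆ₐ[ℂ] A)),
          ∀ f : C(X, ℂ), Tendsto (fun l => η (πnet l f)) atTop
            (@nhds B (ultraStarStrongTopology B) (π f)),
      ∀ (ν : Measure X) [IsProbabilityMeasure ν] [ν.Regular],
        ∃ (Ω : Type u) (_ : Preorder Ω) (_ : IsDirectedOrder Ω) (_ : Nonempty Ω)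
          (ρ : Ω → (C(X, ℂ) →⋆ₐ[ℂ] C(I, ℂ))),
          ∀ f : C(X, ℂ), Tendsto (fun w => ∫ t : I, ρ w f t) atTop (𝓝 (∫ x, f x ∂ν))] := by
  tfae_have 1 → 2 := fun hX A B _ _ _ η hη π => by
    obtain ⟨Y, _, _, _, ι, τ, hinj, hmem, hcomm, hπ⟩ := exists_bicommutant_representation π
    have := extremallyDisconnected_of_awStarAlgebra hinj hmem hcomm
    obtain ⟨Λ, i1, i2, i3, ρ, hρ⟩ := hX.exists_net_tendsto hη ι τ hπ
    exact ⟨Λ, i1, i2, i3, ρ, fun f =>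
      ((toWeakSpaceCLM ℂ B).continuous.tendsto _).comp (hρ f)⟩
  tfae_have 1 → 3 := fun hX A B _ _ _ _ _ η hη π => by
    obtain ⟨Y, _, _, _, ι, τ, hinj, hmem, hcomm, hπ⟩ := exists_bicommutant_representation π
    have := extremallyDisconnected_of_wStarAlgebra hinj hmem hcomm
    obtain ⟨Λ, i1, i2, i3, ρ, hρ⟩ := hX.exists_net_tendsto hη ι τ hπ
    exact ⟨Λ, i1, i2, i3, ρ, fun f =>
      (hρ f).mono_right (nhds_mono (le_ultraStarStrongTopology B))⟩
  tfae_have 1 → 4 := fun hX ν _ _ => hX.exists_net_tendsto_integral ν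
  tfae_have 2 → 1 := approximatelyPathConnected_of_weak_lift.{u, v}
  tfae_have 3 → 1 := approximatelyPathConnected_of_ultraStarStrong_lift.{u, v}
  tfae_have 4 → 1 := approximatelyPathConnected_of_integral
  tfae_finish
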